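/- Let $N\ge 2$ and let $H:[0,1]\to\mathbb{C}^{N\times N}$ be a twice-differentiable Hermitian Hamiltonian with bounded second derivative, having for every $s\in[0,1]$ exactly two distinct energy levels: a non-degenerate level $E_G(s)$ and an $(N-1)$-fold degenerate level $E_1(s)\neq E_G(s)$. Let $|\nu(s)\rangle$, $\nu\in\{0,\dots,N-1\}$ (one of the labels being $G$), be an orthonormal basis of instantaneous eigenvectors of $H(s)$ with eigenvalues $E_\nu(s)$ (so $E_\nu=E_1$ for $\nu\ne G$), depending differentiably on $s$ and chosen such that $\langle\dot\nu(s)|\mu(s)\rangle=0$ whenever $E_\nu\equiv E_\mu$ (in particular for $\nu=\mu$), and put $\beta_{\nu,\mu}(s)=\langle\dot\nu(s)|\mu(s)\rangle$. For $T>0$ let $U(s,0)$ be the time-evolution operator: $i\,\partial_sU(s,0)=T\,H(s)\,U(s,0)$, $U(0,0)=1$. The adiabatic error is $(1-P_G(1))\,U(1,0)|G(0)\rangle$, where $P_G(1)=|G(1)\rangle\langle G(1)|$. For $q\ge 0$ let $$C_q=\sum_{\nu_1,\dots,\nu_q}\int_0^1\!\!\int_0^{s_q}\!\!\cdots\int_0^{s_2}\Big(\prod_{k=1}^{q}\beta_{\nu_k,\nu_{k-1}}(s_k)\Big)e^{-iT\sum_{k=0}^{q}\int_{s_k}^{s_{k+1}}E_{\nu_k}(\xi)\,d\xi}\,ds_1\cdots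 ds_q\;|\nu_q(1)\rangle$$ (with $\nu_0=G$, $s_0=0$, $s_{q+1}=1$, and the sum over all labels with $\nu_k\ne\nu_{k-1}$ for $1\le k\le q$ and $\nu_q\neq G$) be the contribution of the non-adiabatic $q$-jump paths to this error; in particular $$C_1=\sum_{\nu\ne G}\int_0^1e^{-iT\left(\int_{s}^1E_\nu(\xi)d\xi+\int_0^{s}E_G(\xi)d\xi\right)}\beta_{\nu,G}(s)\,ds\;|\nu(1)\rangle .$$ Let $\|\dot H\|=\max_{s}\|\dot H(s)\|$ and $\|\ddot H\|=\sup_{s}\|\ddot H(s)\|$ (operator norms, $s\in[0,1]$), $\gamma_{\min}=\min_{s\in[0,1]}|E_G(s)-E_1(s)|$, and $$\Gamma=\frac{6\|\dot H\|^3}{\gamma_{\min}^3}+\frac{\|\dot H\|\,\|\ddot H\|}{\gamma_{\min}^2}+\frac{2\|\dot H\|^2}{\gamma_{\min}^2}.$$ Then paths with an even number of jumps do not contribute to the error, i.e. $C_{2m}=0$ for all $m\ge0$, and $$\Big\|(1-P_G(1))U(1,0)|G(0)\rangle-C_1\Big\|\le\frac{\Gamma}{\|\dot H\|\,T}\left(e^{\Gamma/(\gamma_{\min}T)}-1\right),$$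 where the right-hand side is read as $0$ if $\|\dot H\|=0$. -/

import Mathlib

open Set

namespace Adiabatic

noncomputable section

/-- The Hilbert space `ℂ^N`. -/
abbrev Ket (N : ℕ) : Type := EuclideanSpace ℂ (Fin N)

/-- Operators on `ℂ^N` (complex `N × N` matrices) with the operator norm. -/
abbrev Op (N : ℕ) : Type := Ket N →L[ℂ] Ket N

/-- Derivative with respect to dimensionless time `s ∈ [0,1]` (one-sided at the end points). -/
def dot {F : Type*} [NormedAddCommGroup F] [NormedSpace ℝ F] (f : ℝ → F) : ℝ → F :=
  derivWithin f (Icc 0 1)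

/-- `f` is twice differentiable on `[0,1]`. -/
def TwiceDifferentiable {F : Type*} [NormedAddCommGroup F] [NormedSpace ℝ F]
    (f : ℝ → F) : Prop :=
  DifferentiableOn ℝ f (Icc 0 1) ∧ DifferentiableOn ℝ (dot f) (Icc 0 1)

/-- The maximum (supremum) over `s ∈ [0,1]` of `‖f s‖`. -/
def maxNorm {F : Type*} [NormedAddCommGroup F] (f : ℝ → F) : ℝ :=
  sSup ((fun s => ‖f s‖) '' Icc 0 1)

/-- `U s` is the time-evolution operator `U(s,0)` generated by `H` over a total time `T`:
it solves `i dU/ds = T H(s) U(s)`, `U(0) = 1` on `[0,1]`. -/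
structure IsTimeEvolution {N : ℕ} (H : ℝ → Op N) (T : ℝ) (U : ℝ → Op N) : Prop where
  initial : U 0 = 1
  schrodinger : ∀ s ∈ Icc (0 : ℝ) 1,
    HasDerivWithinAt U ((-(Complex.I * (T : ℂ))) • (H s * U s)) (Icc 0 1) s

/-- `v n s` is an orthonormal basis of instantaneous eigenvectors `|n(s)⟩` of `H(s)`, with
eigenvalues `E n s`, depending differentiably on `s`, and chosen such that `⟨ṅ(s)|m(s)⟩ = 0`
whenever the eigenvalues of `n` and `m` coincide identically (in particular for `n = m`). -/
structure IsEigenframe {N : ℕ} (H : ℝ → Op N) (E : Fin N → ℝ → ℝ)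
    (v : Fin N → ℝ → Ket N) : Prop where
  differentiable : ∀ n, DifferentiableOn ℝ (v n) (Icc 0 1)
  orthonormal : ∀ s ∈ Icc (0 : ℝ) 1, Orthonormal ℂ (fun n => v n s)
  eigen : ∀ s ∈ Icc (0 : ℝ) 1, ∀ n, H s (v n s) = (E n s : ℂ) • v n s
  gauge : ∀ n m, EqOn (E n) (E m) (Icc 0 1) →
    ∀ s ∈ Icc (0 : ℝ) 1, inner ℂ (dot (v n) s) (v m s) = 0

/-- The tunneling amplitude `β_{n,m}(s) = ⟨ṅ(s)|m(s)⟩`. -/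
def beta {N : ℕ} (v : Fin N → ℝ → Ket N) (n m : Fin N) (s : ℝ) : ℂ :=
  inner ℂ (dot (v n) s) (v m s)

/-- The dynamical phase factor `exp(-i T ∫_a^b E_n(ξ) dξ)`. -/
def phase {N : ℕ} (E : Fin N → ℝ → ℝ) (T : ℝ) (n : Fin N) (a b : ℝ) : ℂ :=
  Complex.exp (-(Complex.I * (T : ℂ) * ((∫ ξ in a..b, E n ξ : ℝ) : ℂ)))

/-- The amplitude at time `x` of all paths that visit the states `ν 0, ν 1, …, ν q` in this
order: the integral over all jump times `0 ≤ s₁ ≤ ⋯ ≤ s_q ≤ x` of the product of the tunneling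
amplitudes `β_{ν k, ν (k-1)}(s_k)` and of the dynamical phases picked up between the jumps. -/
def pathAmplitude {N : ℕ} (E : Fin N → ℝ → ℝ) (v : Fin N → ℝ → Ket N) (T : ℝ) :
    (q : ℕ) → (Fin (q + 1) → Fin N) → ℝ → ℂ
  | 0, ν, x => phase E T (ν 0) 0 x
  | q + 1, ν, x =>
      ∫ s in (0 : ℝ)..x,
        phase E T (ν (Fin.last (q + 1))) s x *
          beta v (ν (Fin.last (q + 1))) (ν (Fin.last q).castSucc) s *
          pathAmplitude E v T q (fun i => ν i.castSucc) s

/-- Label sequences of the non-adiabatic `q`-jump paths: they start in `G`, consecutive labels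
differ, and the last label is not `G`. -/
def nonadiabaticPaths {N : ℕ} (G : Fin N) (q : ℕ) : Finset (Fin (q + 1) → Fin N) :=
  {ν | ν 0 = G ∧ (∀ i : Fin q, ν i.succ ≠ ν i.castSucc) ∧ ν (Fin.last q) ≠ G}

/-- `C_q`: the contribution of all non-adiabatic `q`-jump paths to the adiabatic error. -/
def jumpContribution {N : ℕ} (E : Fin N → ℝ → ℝ) (v : Fin N → ℝ → Ket N) (T : ℝ)
    (G : Fin N) (q : ℕ) : Ket N :=
  ∑ ν ∈ nonadiabaticPaths G q, pathAmplitude E v T q ν 1 • v (ν (Fin.last q)) 1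

/-- The adiabatic error `(1 - |G(1)⟩⟨G(1)|) U(1,0) |G(0)⟩`. -/
def adiabaticError {N : ℕ} (U : ℝ → Op N) (v : Fin N → ℝ → Ket N) (G : Fin N) : Ket N :=
  (1 - InnerProductSpace.rankOne ℂ (v G 1) (v G 1) : Op N) (U 1 (v G 0))

/-- `γ_min`: the minimum over `s ∈ [0,1]` of the gap between distinct energies. -/
def minGap {N : ℕ} (E : Fin N → ℝ → ℝ) : ℝ :=
  sInf {g | ∃ s ∈ Icc (0 : ℝ) 1, ∃ n m, E n s ≠ E m s ∧ g = |E n s - E m s|}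

/-- `Γ` as a function of `h₁ = ‖Ḣ‖`, `h₂ = ‖Ḧ‖` and `g = γ_min`. -/
def Gam (h₁ h₂ g : ℝ) : ℝ :=
  (6 * h₁ ^ 3 / g ^ 3 + h₁ * h₂ / g ^ 2) + 2 * h₁ ^ 2 / g ^ 2

end

end Adiabatic

/- In the interaction picture the amplitude of `G` has modulus at most `1`, and the excited
amplitudes are driven by it through the couplings `β_{n,G}`, which oscillate with the phase
`T ∫ (E_1 - E_G)`; the excited level does not couple to itself because the gauge makes all `β`
inside it vanish. Integrating by parts against the oscillation makes the excited amplitudes of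
order `1 / T`, by Grönwall's inequality. Hence the amplitude of `G` stays within order `1 / T` of
`1`. Now `C_1` is what the excited amplitudes would be if the amplitude of `G` were exactly `1`, so
a second integration by parts, of the difference, gains another factor `1 / T`.
A path with an even number of jumps that ends outside `G` has a jump inside the excited level, so
one of the factors `β` of its amplitude vanishes. -/

namespace Adiabatic

theorem hasDerivWithinAt_integral_Icc {F : Type*} [NormedAddCommGroup F] [NormedSpace ℝ F]
    [CompleteSpace F] {f : ℝ → F} {a b s : ℝ} (hf : ContinuousOn f (Icc a b))
    (hs : s ∈ Icc a b) :
    HasDerivWithinAt (fun x => ∫ ξ in a..x, f ξ) (f s) (Icc a b) s := by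
  have : Fact (s ∈ Icc a b) := ⟨hs⟩
  exact intervalIntegral.integral_hasDerivWithinAt_right
    ((hf.mono (Icc_subset_Icc_right hs.2)).intervalIntegrable_of_Icc hs.1)
    (hf.stronglyMeasurableAtFilter_nhdsWithin measurableSet_Icc s) (hf s hs)

theorem hasDerivWithinAt_clm_apply {V W : Type*} [NormedAddCommGroup V] [NormedSpace ℂ V]
    [NormedAddCommGroup W] [NormedSpace ℂ W] {A : ℝ → V →L[ℂ] W} {x : ℝ → V} {A' : V →L[ℂ] W}
    {x' : V} {t : Set ℝ} {s : ℝ} (hA : HasDerivWithinAt A A' t s)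
    (hx : HasDerivWithinAt x x' t s) :
    HasDerivWithinAt (fun s => A s (x s)) (A' (x s) + A s x') t s :=
  ((ContinuousLinearMap.restrictScalarsL ℂ V W ℝ ℝ).hasFDerivAt.comp_hasDerivWithinAt
    s hA).clm_apply hx

theorem gronwallBound_add_const (δ K ε c x : ℝ) :
    gronwallBound δ K (ε + K * c) x + c = gronwallBound (δ + c) K ε x := by
  rcases eq_or_ne K 0 with rfl | hK
  · simp only [gronwallBound_K0]
    ring
  · simp only [gronwallBound_of_K_ne_0 hK]
    field_simp
    ring

theorem gronwallBound_le_mul_exp {δ K ε x : ℝ} (hK : 0 ≤ K) (hε : 0 ≤ ε) :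
    gronwallBound δ K ε x ≤ (δ + ε * x) * Real.exp (K * x) := by
  rcases hK.eq_or_lt with rfl | hK
  · simp [gronwallBound_K0]
  have hexp : Real.exp (K * x) - 1 ≤ K * x * Real.exp (K * x) := by
    have h := mul_le_mul_of_nonneg_right (Real.one_sub_le_exp_neg (K * x)) (Real.exp_nonneg (K * x))
    rw [← Real.exp_add, neg_add_cancel, Real.exp_zero] at h
    linarith
  calc gronwallBound δ K ε x
      = δ * Real.exp (K * x) + ε / K * (Real.exp (K * x) - 1) := by
        rw [gronwallBound_of_K_ne_0 hK.ne']
    _ ≤ δ * Real.exp (K * x) + ε / K * (K * x * Real.exp (K * x)) := by gcongr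
    _ = (δ + ε * x) * Real.exp (K * x) := by field_simp

theorem mul_exp_half_le_exp_sub_one {x : ℝ} (hx : 0 ≤ x) :
    x * Real.exp (x / 2) ≤ Real.exp x - 1 := by
  have hsinh : x / 2 ≤ Real.sinh (x / 2) := Real.self_le_sinh_iff.2 (by positivity)
  calc x * Real.exp (x / 2) ≤ 2 * Real.sinh (x / 2) * Real.exp (x / 2) := by
        gcongr
        linarith
    _ = Real.exp (x / 2 + x / 2) - Real.exp (-(x / 2) + x / 2) := by
        rw [Real.sinh_eq, Real.exp_add, Real.exp_add]
        ring
    _ = Real.exp x - 1 := by rw [add_halves, neg_add_cancel, Real.exp_zero]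

theorem mul_sq_mul_exp_le_gam {h₁ h₂ γ T p r : ℝ} (hh₁ : 0 ≤ h₁) (hγ : 0 < γ) (hT : 0 < T)
    (hp : p = h₁ / γ ^ 2 / T) (hr : r = (6 * h₁ ^ 2 / γ ^ 3 + h₂ / γ ^ 2) / T) (hr₀ : 0 ≤ r) :
    h₁ / γ * (2 * p + r) ^ 2 * Real.exp (h₁ / γ * p)
      ≤ Gam h₁ h₂ γ / (h₁ * T) * (Real.exp (Gam h₁ h₂ γ / (γ * T)) - 1) := by
  rcases hh₁.eq_or_lt with rfl | hh₁
  · simp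
  have hexponent : Gam h₁ h₂ γ / (γ * T) = h₁ / γ * (2 * p + r) := by
    rw [hp, hr, Gam]
    field_simp
    ring
  have hfactor : Gam h₁ h₂ γ / (h₁ * T) = 2 * p + r := by
    rw [hp, hr, Gam]
    field_simp
    ring
  have hp₀ : 0 ≤ p := by
    rw [hp]
    positivity
  rw [hexponent, hfactor]
  calc h₁ / γ * (2 * p + r) ^ 2 * Real.exp (h₁ / γ * p)
      ≤ h₁ / γ * (2 * p + r) ^ 2 * Real.exp (h₁ / γ * (2 * p + r) / 2) := by
        rw [mul_div_assoc]
        gcongr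
        linarith
    _ = (2 * p + r) * (h₁ / γ * (2 * p + r) * Real.exp (h₁ / γ * (2 * p + r) / 2)) := by ring
    _ ≤ (2 * p + r) * (Real.exp (h₁ / γ * (2 * p + r)) - 1) := by
        gcongr
        exact mul_exp_half_le_exp_sub_one (by positivity)

section AdiabaticElimination

variable {W : Type*} [NormedAddCommGroup W] [NormedSpace ℝ W] {t₀ t₁ s : ℝ}

theorem norm_le_of_hasDerivWithinAt_sub {b c z' : ℝ → W} {K p r : ℝ} (hK : 0 ≤ K)
    (hbc : ∀ s ∈ Icc t₀ t₁, HasDerivWithinAt (fun x => b x - c x) (z' s) (Icc t₀ t₁) s)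
    (hz'_le : ∀ s ∈ Icc t₀ t₁, ‖z' s‖ ≤ K * ‖b s‖ + r) (hr : 0 ≤ r)
    (hc_le : ∀ s ∈ Icc t₀ t₁, ‖c s‖ ≤ p) (hb₀ : b t₀ = 0) (hs : s ∈ Icc t₀ t₁) :
    ‖b s‖ ≤ (2 * p + r * (t₁ - t₀)) * Real.exp (K * (t₁ - t₀)) := by
  have h₀ : t₀ ∈ Icc t₀ t₁ := left_mem_Icc.2 (hs.1.trans hs.2)
  have hp : 0 ≤ p := (norm_nonneg _).trans (hc_le s hs)
  let z : ℝ → W := fun x => b x - c x - (b t₀ - c t₀)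
  have hz : ∀ x ∈ Icc t₀ t₁, HasDerivWithinAt z (z' x) (Icc t₀ t₁) x := fun x hx =>
    (hbc x hx).sub_const _
  have hbz : ∀ x ∈ Icc t₀ t₁, ‖b x‖ ≤ ‖z x‖ + 2 * p := fun x hx => by
    have hbx : b x = z x + (c x - c t₀) := by
      simp only [z, hb₀]
      abel
    calc ‖b x‖ ≤ ‖z x‖ + (‖c x‖ + ‖c t₀‖) := by
          rw [hbx]
          exact (norm_add_le _ _).trans (add_le_add_right (norm_sub_le _ _) _)
      _ ≤ ‖z x‖ + 2 * p := by linarith [hc_le x hx, hc_le t₀ h₀]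
  have hz'_le_z : ∀ x ∈ Icc t₀ t₁, ‖z' x‖ ≤ K * ‖z x‖ + (r + K * (2 * p)) := fun x hx => by
    linarith [hz'_le x hx, mul_le_mul_of_nonneg_left (hbz x hx) hK]
  have hz_le : ‖z s‖ ≤ gronwallBound 0 K (r + K * (2 * p)) (s - t₀) :=
    norm_le_gronwallBound_of_norm_deriv_right_le (fun x hx => (hz x hx).continuousWithinAt)
      (fun x hx => (hz x (Ico_subset_Icc_self hx)).mono_of_mem_nhdsWithin
        (Icc_mem_nhdsGE_of_mem hx))
      (by simp [z]) (fun x hx => hz'_le_z x (Ico_subset_Icc_self hx)) s hs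
  calc ‖b s‖ ≤ gronwallBound 0 K (r + K * (2 * p)) (s - t₀) + 2 * p :=
        (hbz s hs).trans (by gcongr)
    _ = gronwallBound (2 * p) K r (s - t₀) := by rw [gronwallBound_add_const, zero_add]
    _ ≤ (2 * p + r * (s - t₀)) * Real.exp (K * (s - t₀)) := gronwallBound_le_mul_exp hK hr
    _ ≤ (2 * p + r * (t₁ - t₀)) * Real.exp (K * (t₁ - t₀)) := by
        have := sub_nonneg.2 (hs.1.trans hs.2)
        have := hs.2
        gcongr

variable {𝕜 : Type*} [RCLike 𝕜] [NormedSpace 𝕜 W] [IsScalarTower ℝ 𝕜 W] {κ p r : ℝ}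
  {a a' : ℝ → 𝕜} {b A B D R : ℝ → W}

theorem hasDerivWithinAt_sub_smul_primitive {t : Set ℝ} {c : ℝ → 𝕜} {c' : 𝕜} {f : ℝ → W}
    (hf : HasDerivWithinAt f (c s • B s) t s) (hc : HasDerivWithinAt c c' t s)
    (hA : HasDerivWithinAt A (B s + R s) t s) :
    HasDerivWithinAt (fun x => f x - c x • A x) (-(c s • R s + c' • A s)) t s := by
  refine (hf.sub (hc.smul hA)).congr_deriv ?_
  rw [smul_add]
  abel

variable (hκ : 0 ≤ κ)
  (ha : ∀ s ∈ Icc t₀ t₁, HasDerivWithinAt a (a' s) (Icc t₀ t₁) s)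
  (hb : ∀ s ∈ Icc t₀ t₁, HasDerivWithinAt b (a s • B s) (Icc t₀ t₁) s)
  (hA : ∀ s ∈ Icc t₀ t₁, HasDerivWithinAt A (B s + R s) (Icc t₀ t₁) s)
  (ha_le : ∀ s ∈ Icc t₀ t₁, ‖a s‖ ≤ 1)
  (ha'_le : ∀ s ∈ Icc t₀ t₁, ‖a' s‖ ≤ κ * ‖b s‖)
  (hA_le : ∀ s ∈ Icc t₀ t₁, ‖A s‖ ≤ p)
  (hR_le : ∀ s ∈ Icc t₀ t₁, ‖R s‖ ≤ r)
  (hb₀ : b t₀ = 0)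
include hκ ha hb hA ha_le ha'_le hA_le hR_le hb₀

/- Integrating by parts against the approximate primitive `A` of the coupling `B` makes `b` of
the size of `A` and `R`; Grönwall's inequality absorbs the remaining term `a' • A`. -/
theorem norm_le_of_approxPrimitive (hs : s ∈ Icc t₀ t₁) :
    ‖b s‖ ≤ (2 * p + r * (t₁ - t₀)) * Real.exp (κ * p * (t₁ - t₀)) := by
  have hp : 0 ≤ p := (norm_nonneg _).trans (hA_le s hs)
  have hr : 0 ≤ r := (norm_nonneg _).trans (hR_le s hs)
  refine norm_le_of_hasDerivWithinAt_sub (by positivity)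
    (fun x hx => hasDerivWithinAt_sub_smul_primitive (hb x hx) (ha x hx) (hA x hx))
    (fun x hx => ?_) hr (fun x hx => ?_) hb₀ hs
  · calc ‖-(a x • R x + a' x • A x)‖ ≤ ‖a x‖ * ‖R x‖ + ‖a' x‖ * ‖A x‖ := by
          rw [norm_neg, ← norm_smul, ← norm_smul]
          exact norm_add_le _ _
      _ ≤ 1 * r + κ * ‖b x‖ * p := by
          gcongr
          exacts [ha_le x hx, hR_le x hx, ha'_le x hx, hA_le x hx]
      _ = κ * p * ‖b x‖ + r := by ring
  · simpa only [norm_smul, one_mul] using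
      mul_le_mul (ha_le x hx) (hA_le x hx) (norm_nonneg _) zero_le_one

theorem norm_sub_initial_le_of_approxPrimitive (hs : s ∈ Icc t₀ t₁) :
    ‖a s - a t₀‖
      ≤ κ * ((2 * p + r * (t₁ - t₀)) * Real.exp (κ * p * (t₁ - t₀))) * (t₁ - t₀) := by
  have ha'_le' : ∀ x ∈ Icc t₀ t₁,
      ‖a' x‖ ≤ κ * ((2 * p + r * (t₁ - t₀)) * Real.exp (κ * p * (t₁ - t₀))) := fun x hx =>
    (ha'_le x hx).trans (mul_le_mul_of_nonneg_left
      (norm_le_of_approxPrimitive hκ ha hb hA ha_le ha'_le hA_le hR_le hb₀ hx) hκ)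
  refine (norm_image_sub_le_of_norm_deriv_le_segment' ha
    (fun x hx => ha'_le' x (Ico_subset_Icc_self hx)) s hs).trans ?_
  gcongr
  exacts [(norm_nonneg _).trans (ha'_le' s hs), hs.2]

/- `b - D` solves the equation of `b` with `a - 1` in place of `a`, and `a - 1` is already small:
a second integration by parts gains one more order. -/
theorem norm_sub_le_of_approxPrimitive (ha₀ : a t₀ = 1)
    (hD : ∀ s ∈ Icc t₀ t₁, HasDerivWithinAt D (B s) (Icc t₀ t₁) s) (hD₀ : D t₀ = 0)
    (hs : s ∈ Icc t₀ t₁) :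
    ‖b s - D s‖ ≤ κ * (t₁ - t₀) * (2 * p + r * (t₁ - t₀)) ^ 2
      * Real.exp (κ * p * (t₁ - t₀)) := by
  have hL : 0 ≤ t₁ - t₀ := sub_nonneg.2 (hs.1.trans hs.2)
  have hp : 0 ≤ p := (norm_nonneg _).trans (hA_le s hs)
  have hr : 0 ≤ r := (norm_nonneg _).trans (hR_le s hs)
  set M := (2 * p + r * (t₁ - t₀)) * Real.exp (κ * p * (t₁ - t₀)) with hM
  have ha'_leM : ∀ x ∈ Icc t₀ t₁, ‖a' x‖ ≤ κ * M := fun x hx =>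
    (ha'_le x hx).trans (mul_le_mul_of_nonneg_left
      (norm_le_of_approxPrimitive hκ ha hb hA ha_le ha'_le hA_le hR_le hb₀ hx) hκ)
  have ha_sub : ∀ x ∈ Icc t₀ t₁, ‖a x - 1‖ ≤ κ * M * (t₁ - t₀) := fun x hx => by
    rw [← ha₀]
    exact norm_sub_initial_le_of_approxPrimitive hκ ha hb hA ha_le ha'_le hA_le hR_le hb₀ hx
  let w : ℝ → W := fun x => b x - D x - (a x - 1) • A x
  have hw : ∀ x ∈ Icc t₀ t₁,
      HasDerivWithinAt w (-((a x - 1) • R x + a' x • A x)) (Icc t₀ t₁) x := fun x hx =>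
    hasDerivWithinAt_sub_smul_primitive
      (((hb x hx).sub (hD x hx)).congr_deriv (by rw [sub_smul, one_smul]))
      ((ha x hx).sub_const 1) (hA x hx)
  have hw'_le : ∀ x ∈ Icc t₀ t₁,
      ‖-((a x - 1) • R x + a' x • A x)‖ ≤ κ * M * (t₁ - t₀) * r + κ * M * p := fun x hx => by
    rw [norm_neg]
    refine norm_add_le_of_le ?_ ?_ <;> rw [norm_smul]
    · exact mul_le_mul (ha_sub x hx) (hR_le x hx) (norm_nonneg _) (by positivity)
    · exact mul_le_mul (ha'_leM x hx) (hA_le x hx) (norm_nonneg _) (by positivity)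
  have hw_le : ‖w s‖ ≤ (κ * M * (t₁ - t₀) * r + κ * M * p) * (t₁ - t₀) := by
    have hw₀ : w t₀ = 0 := by simp [w, ha₀, hb₀, hD₀]
    rw [← sub_zero (w s), ← hw₀]
    refine (norm_image_sub_le_of_norm_deriv_le_segment' hw
      (fun x hx => hw'_le x (Ico_subset_Icc_self hx)) s hs).trans ?_
    gcongr
    exact hs.2
  have haA_le : ‖(a s - 1) • A s‖ ≤ κ * M * (t₁ - t₀) * p := by
    rw [norm_smul]
    exact mul_le_mul (ha_sub s hs) (hA_le s hs) (norm_nonneg _) (by positivity)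
  calc ‖b s - D s‖ = ‖w s + (a s - 1) • A s‖ := by simp only [w, sub_add_cancel]
    _ ≤ (κ * M * (t₁ - t₀) * r + κ * M * p) * (t₁ - t₀) + κ * M * (t₁ - t₀) * p :=
        norm_add_le_of_le hw_le haA_le
    _ = κ * (t₁ - t₀) * (2 * p + r * (t₁ - t₀)) ^ 2 * Real.exp (κ * p * (t₁ - t₀)) := by
        rw [hM]
        ring

end AdiabaticElimination

section FrameCoordinates

variable {𝕜 V ι : Type*} [RCLike 𝕜] [NormedAddCommGroup V] [InnerProductSpace 𝕜 V]
  [DecidableEq ι]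

/-- The coordinates of `x` in the frame `e`, with the one along `e g` replaced by `0`; for an
orthonormal basis `e`, the coordinate vector of the component of `x` orthogonal to `e g`. -/
noncomputable def excitedCoords (𝕜 : Type*) {V ι : Type*} [RCLike 𝕜] [NormedAddCommGroup V]
    [InnerProductSpace 𝕜 V] [DecidableEq ι] (e : ι → V) (g : ι) (x : V) : EuclideanSpace 𝕜 ι :=
  WithLp.toLp 2 fun n => if n = g then 0 else inner 𝕜 (e n) x

@[simp]
theorem excitedCoords_apply_self (e : ι → V) (g : ι) (x : V) : excitedCoords 𝕜 e g x g = 0 :=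
  if_pos rfl

theorem excitedCoords_apply_of_ne (e : ι → V) {g n : ι} (hn : n ≠ g) (x : V) :
    excitedCoords 𝕜 e g x n = inner 𝕜 (e n) x :=
  if_neg hn

theorem excitedCoords_smul (e : ι → V) (g : ι) (c : 𝕜) (x : V) :
    excitedCoords 𝕜 e g (c • x) = c • excitedCoords 𝕜 e g x := by
  ext n
  simp [excitedCoords, inner_smul_right]

theorem excitedCoords_self {e : ι → V} (he : Orthonormal 𝕜 e) (g : ι) :
    excitedCoords 𝕜 e g (e g) = 0 := by
  ext n
  by_cases hn : n = g
  · simp [hn]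
  · simp [excitedCoords_apply_of_ne e hn, he.2 hn]

variable [Fintype ι]

theorem norm_excitedCoords_le {e : ι → V} (he : Orthonormal 𝕜 e) (g : ι) (x : V) :
    ‖excitedCoords 𝕜 e g x‖ ≤ ‖x‖ := by
  refine (sq_le_sq₀ (norm_nonneg _) (norm_nonneg _)).1 ?_
  calc ‖excitedCoords 𝕜 e g x‖ ^ 2 = ∑ n, ‖excitedCoords 𝕜 e g x n‖ ^ 2 :=
        EuclideanSpace.norm_sq_eq _
    _ ≤ ∑ n, ‖inner 𝕜 (e n) x‖ ^ 2 := by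
        refine Finset.sum_le_sum fun n _ => ?_
        by_cases hn : n = g
        · simp [hn]
        · rw [excitedCoords_apply_of_ne e hn]
    _ ≤ ‖x‖ ^ 2 := he.sum_inner_products_le x

variable (e : OrthonormalBasis ι 𝕜 V) (g : ι)

theorem repr_symm_excitedCoords (x : V) :
    e.repr.symm (excitedCoords 𝕜 e g x) = x - inner 𝕜 (e g) x • e g := by
  refine e.repr.injective ?_
  ext n
  by_cases hn : n = g
  · simp [hn, e.repr_apply_apply]
  · simp [hn, e.repr_apply_apply, excitedCoords_apply_of_ne _ hn]

theorem norm_excitedCoords_of_inner_eq_zero {x : V} (hx : inner 𝕜 (e g) x = 0) :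
    ‖excitedCoords 𝕜 e g x‖ = ‖x‖ := by
  rw [← e.repr.symm.norm_map, repr_symm_excitedCoords, hx, zero_smul, sub_zero]

theorem inner_excitedCoords (x y : V) :
    inner 𝕜 (excitedCoords 𝕜 e g x) (excitedCoords 𝕜 e g y)
      = inner 𝕜 x y - inner 𝕜 x (e g) * inner 𝕜 (e g) y := by
  rw [← e.repr.symm.inner_map_map, repr_symm_excitedCoords, repr_symm_excitedCoords]
  simp only [inner_sub_left, inner_sub_right, inner_smul_left, inner_smul_right,
    inner_conj_symm, e.inner_eq_one]
  ring

end FrameCoordinates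

section UnitInterval

variable {F : Type*} [NormedAddCommGroup F] {f : ℝ → F} {s : ℝ} (hs : s ∈ Icc (0 : ℝ) 1)
include hs

theorem hasDerivWithinAt_dot [NormedSpace ℝ F] (hf : DifferentiableOn ℝ f (Icc 0 1)) :
    HasDerivWithinAt f (dot f s) (Icc 0 1) s :=
  (hf s hs).hasDerivWithinAt

theorem dot_eq [NormedSpace ℝ F] {f' : F} (hf : HasDerivWithinAt f f' (Icc 0 1) s) :
    dot f s = f' :=
  hf.derivWithin (uniqueDiffOn_Icc_zero_one s hs)

theorem norm_le_maxNorm (hf : BddAbove ((fun s => ‖f s‖) '' Icc 0 1)) : ‖f s‖ ≤ maxNorm f :=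
  le_csSup hf ⟨s, hs, rfl⟩

end UnitInterval

variable {N : ℕ} {H : ℝ → Op N} {E : Fin N → ℝ → ℝ} {v : Fin N → ℝ → Ket N} {G k : Fin N}
  {s T : ℝ}

section Phase

variable {n m : Fin N} {a b c : ℝ}

theorem phase_ne_zero : phase E T n a b ≠ 0 :=
  Complex.exp_ne_zero _

theorem phase_self : phase E T n a a = 1 := by
  simp [phase]

theorem norm_phase : ‖phase E T n a b‖ = 1 := by
  have h : -(Complex.I * (T : ℂ) * ((∫ ξ in a..b, E n ξ : ℝ) : ℂ))
      = ((-(T * ∫ ξ in a..b, E n ξ) : ℝ) : ℂ) * Complex.I := by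
    push_cast
    ring
  rw [phase, h, Complex.norm_exp_ofReal_mul_I]

theorem phase_congr (ha : a ∈ Icc (0 : ℝ) 1) (hb : b ∈ Icc (0 : ℝ) 1)
    (hE : EqOn (E n) (E m) (Icc 0 1)) : phase E T n a b = phase E T m a b := by
  rw [phase, phase, intervalIntegral.integral_congr (hE.mono (ordConnected_Icc.uIcc_subset ha hb))]

theorem phase_mul_phase (hE : ContinuousOn (E n) (Icc 0 1)) (ha : a ∈ Icc (0 : ℝ) 1)
    (hb : b ∈ Icc (0 : ℝ) 1) (hc : c ∈ Icc (0 : ℝ) 1) :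
    phase E T n a b * phase E T n b c = phase E T n a c := by
  have hint : ∀ {x y}, x ∈ Icc (0 : ℝ) 1 → y ∈ Icc (0 : ℝ) 1 →
      IntervalIntegrable (E n) MeasureTheory.volume x y := fun hx hy =>
    (hE.mono (ordConnected_Icc.uIcc_subset hx hy)).intervalIntegrable
  rw [phase, phase, phase, ← Complex.exp_add,
    ← intervalIntegral.integral_add_adjacent_intervals (hint ha hb) (hint hb hc)]
  push_cast
  ring_nf

theorem hasDerivWithinAt_phase (hE : ContinuousOn (E n) (Icc 0 1)) (hs : s ∈ Icc (0 : ℝ) 1) :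
    HasDerivWithinAt (phase E T n 0) (-(Complex.I * T * E n s) * phase E T n 0 s)
      (Icc 0 1) s := by
  refine (((hasDerivWithinAt_integral_Icc hE hs).ofReal_comp.const_mul
    (Complex.I * T)).fun_neg.cexp).congr_deriv ?_
  rw [phase]
  ring

theorem hasDerivWithinAt_phase_inv (hE : ContinuousOn (E n) (Icc 0 1))
    (hs : s ∈ Icc (0 : ℝ) 1) :
    HasDerivWithinAt (fun t => (phase E T n 0 t)⁻¹)
      (Complex.I * T * E n s * (phase E T n 0 s)⁻¹) (Icc 0 1) s := by
  have hne : phase E T n 0 s ≠ 0 := phase_ne_zero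
  refine ((hasDerivWithinAt_phase hE hs).fun_inv hne).congr_deriv ?_
  field_simp

end Phase

theorem norm_eq_of_schrodinger (hsa : ∀ s ∈ Icc (0 : ℝ) 1, IsSelfAdjoint (H s)) {ψ : ℝ → Ket N}
    (hψ : ∀ s ∈ Icc (0 : ℝ) 1,
      HasDerivWithinAt ψ (-(Complex.I * (T : ℂ)) • H s (ψ s)) (Icc 0 1) s)
    (hs : s ∈ Icc (0 : ℝ) 1) : ‖ψ s‖ = ‖ψ 0‖ := by
  have hd : ∀ t ∈ Icc (0 : ℝ) 1,
      HasDerivWithinAt (fun t => inner ℂ (ψ t) (ψ t)) 0 (Icc 0 1) t := fun t ht => by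
    refine ((hψ t ht).inner ℂ (hψ t ht)).congr_deriv ?_
    have hsymm : inner ℂ (H t (ψ t)) (ψ t) = inner ℂ (ψ t) (H t (ψ t)) :=
      (hsa t ht).isSymmetric (ψ t) (ψ t)
    rw [inner_smul_right, inner_smul_left, hsymm]
    simp
  have h := constant_of_derivWithin_zero (fun t ht => (hd t ht).differentiableWithinAt)
    (fun t ht => dot_eq (Ico_subset_Icc_self ht) (hd t (Ico_subset_Icc_self ht))) s hs
  rw [inner_self_eq_norm_sq_to_K, inner_self_eq_norm_sq_to_K] at h
  exact (sq_eq_sq₀ (norm_nonneg _) (norm_nonneg _)).1 (by exact_mod_cast h)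

theorem IsTimeEvolution.hasDerivWithinAt_apply {U : ℝ → Op N} (hU : IsTimeEvolution H T U)
    (x : Ket N) (hs : s ∈ Icc (0 : ℝ) 1) :
    HasDerivWithinAt (fun t => U t x) (-(Complex.I * (T : ℂ)) • H s (U s x)) (Icc 0 1) s := by
  simpa using hasDerivWithinAt_clm_apply (hU.schrodinger s hs) (hasDerivWithinAt_const s _ x)

/-- The vector of tunneling amplitudes `β_{n,G}` out of the label `G`. -/
noncomputable def tunneling (v : Fin N → ℝ → Ket N) (G : Fin N) (s : ℝ) : Ket N :=
  WithLp.toLp 2 fun n => beta v n G s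

@[simp]
theorem tunneling_apply (n : Fin N) : tunneling v G s n = beta v n G s :=
  rfl

namespace IsEigenframe

variable (h : IsEigenframe H E v) (hs : s ∈ Icc (0 : ℝ) 1)
include h hs

/-- The instantaneous eigenvectors at time `s`, as an orthonormal basis. -/
noncomputable def basis : OrthonormalBasis (Fin N) ℂ (Ket N) :=
  OrthonormalBasis.mk (h.orthonormal s hs)
    ((h.orthonormal s hs).linearIndependent.span_eq_top_of_card_eq_finrank' (by simp)).ge

@[simp]
theorem coe_basis : ⇑(h.basis hs) = (v · s) :=
  OrthonormalBasis.coe_mk _ _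

theorem norm_eq_one (n : Fin N) : ‖v n s‖ = 1 :=
  (h.orthonormal s hs).1 n

theorem norm_apply_le (A : Op N) (n : Fin N) : ‖A (v n s)‖ ≤ ‖A‖ := by
  simpa only [h.norm_eq_one hs, mul_one] using A.le_opNorm (v n s)

theorem hasDerivWithinAt (n : Fin N) : HasDerivWithinAt (v n) (dot (v n) s) (Icc 0 1) s :=
  hasDerivWithinAt_dot hs (h.differentiable n)

theorem beta_self (n : Fin N) : beta v n n s = 0 :=
  h.gauge n n (eqOn_refl _ _) s hs

theorem inner_dot_right (n m : Fin N) : inner ℂ (v n s) (dot (v m) s) = -beta v n m s := by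
  have hd := (h.hasDerivWithinAt hs n).inner ℂ (h.hasDerivWithinAt hs m)
  have hconst : HasDerivWithinAt (fun t => inner ℂ (v n t) (v m t)) 0 (Icc 0 1) s :=
    (hasDerivWithinAt_const s _ (if n = m then (1 : ℂ) else 0)).congr_of_mem
      (fun t ht => orthonormal_iff_ite.1 (h.orthonormal t ht) n m) hs
  exact eq_neg_of_add_eq_zero_left ((dot_eq hs hd).symm.trans (dot_eq hs hconst))

theorem inner_hamiltonian (n : Fin N) (x : Ket N) :
    inner ℂ (v n s) (H s x) = E n s * inner ℂ (v n s) x := by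
  have hbasis : (innerSL ℂ (v n s) ∘L H s).toLinearMap
      = ((E n s : ℂ) • innerSL ℂ (v n s)).toLinearMap := by
    refine (h.basis hs).toBasis.ext fun m => ?_
    rw [OrthonormalBasis.coe_toBasis, h.coe_basis hs]
    change inner ℂ (v n s) (H s (v m s)) = E n s * inner ℂ (v n s) (v m s)
    rw [h.eigen s hs, inner_smul_right]
    rcases eq_or_ne n m with rfl | hnm
    · rfl
    · rw [(h.orthonormal s hs).2 hnm, mul_zero, mul_zero]
  exact DFunLike.congr_fun hbasis x

theorem hasDerivWithinAt_matrixElement (hH : DifferentiableOn ℝ H (Icc 0 1)) (n m : Fin N) :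
    HasDerivWithinAt (fun t => inner ℂ (v n t) (H t (v m t)))
      (inner ℂ (v n s) (dot H s (v m s)) + (E m s - E n s) * beta v n m s) (Icc 0 1) s := by
  refine ((h.hasDerivWithinAt hs n).inner ℂ (hasDerivWithinAt_clm_apply
    (hasDerivWithinAt_dot hs hH) (h.hasDerivWithinAt hs m))).congr_deriv ?_
  rw [inner_add_right, h.inner_hamiltonian hs, h.eigen s hs, inner_smul_right,
    h.inner_dot_right hs, beta]
  ring

theorem hellmann_feynman (hH : DifferentiableOn ℝ H (Icc 0 1)) (n : Fin N) :
    HasDerivWithinAt (E n) (inner ℂ (v n s) (dot H s (v n s))).re (Icc 0 1) s := by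
  have hd := Complex.reCLM.hasFDerivAt.comp_hasDerivWithinAt s
    (h.hasDerivWithinAt_matrixElement hs hH n n)
  rw [sub_self, zero_mul, add_zero] at hd
  refine hd.congr_of_mem (fun t ht => ?_) hs
  simp [h.inner_hamiltonian ht, h.norm_eq_one ht]

theorem abs_dot_energy_le (hH : DifferentiableOn ℝ H (Icc 0 1)) (n : Fin N) :
    |dot (E n) s| ≤ ‖dot H s‖ := by
  rw [dot_eq hs (h.hellmann_feynman hs hH n)]
  calc |(inner ℂ (v n s) (dot H s (v n s))).re| ≤ ‖inner ℂ (v n s) (dot H s (v n s))‖ :=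
        Complex.abs_re_le_norm _
    _ ≤ ‖v n s‖ * ‖dot H s (v n s)‖ := norm_inner_le_norm _ _
    _ ≤ ‖dot H s‖ := by
        rw [h.norm_eq_one hs, one_mul]
        exact h.norm_apply_le hs _ n

theorem inner_dot_hamiltonian (hH : DifferentiableOn ℝ H (Icc 0 1)) {n m : Fin N}
    (hnm : n ≠ m) :
    inner ℂ (v n s) (dot H s (v m s)) = (E n s - E m s) * beta v n m s := by
  have hzero : HasDerivWithinAt (fun t => inner ℂ (v n t) (H t (v m t))) 0 (Icc 0 1) s :=
    (hasDerivWithinAt_const s _ (0 : ℂ)).congr_of_mem (fun t ht => by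
      rw [h.inner_hamiltonian ht, (h.orthonormal t ht).2 hnm, mul_zero]) hs
  have hd := (dot_eq hs (h.hasDerivWithinAt_matrixElement hs hH n m)).symm.trans
    (dot_eq hs hzero)
  linear_combination hd

theorem excitedCoords_dot : excitedCoords ℂ (v · s) G (dot (v G) s) = -tunneling v G s := by
  ext n
  by_cases hn : n = G
  · subst hn
    simp [h.beta_self hs]
  · simp [excitedCoords_apply_of_ne _ hn, h.inner_dot_right hs]

theorem inner_dot_left (x : Ket N) :
    inner ℂ (dot (v G) s) x
      = -inner ℂ (tunneling v G s) (excitedCoords ℂ (v · s) G x) := by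
  have hinner := inner_excitedCoords (h.basis hs) G (dot (v G) s) x
  have hG : inner ℂ (dot (v G) s) (v G s) = 0 := h.beta_self hs G
  simp only [coe_basis, h.excitedCoords_dot hs, hG, zero_mul, sub_zero, inner_neg_left] at hinner
  exact hinner.symm

theorem norm_dot : ‖dot (v G) s‖ = ‖tunneling v G s‖ := by
  rw [← norm_neg (tunneling v G s), ← h.excitedCoords_dot hs, ← h.coe_basis hs]
  refine (norm_excitedCoords_of_inner_eq_zero _ _ ?_).symm
  simp [h.inner_dot_right hs, h.beta_self hs]

omit hs in
theorem continuousOn_energy (hH : DifferentiableOn ℝ H (Icc 0 1)) (n : Fin N) :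
    ContinuousOn (E n) (Icc 0 1) := fun _ hs =>
  (h.hellmann_feynman hs hH n).continuousWithinAt

end IsEigenframe

/-- The energy gap `E_1 - E_G`, with the excited level `E_1` read off at the label `k`. -/
def gap (E : Fin N → ℝ → ℝ) (G k : Fin N) (s : ℝ) : ℝ :=
  E k s - E G s

/-- The first-order adiabatic coefficients `β_{n,G} / (E_1 - E_G)`, which appear when the
oscillating tunneling amplitudes are integrated by parts. -/
noncomputable def tunnelingOverGap (E : Fin N → ℝ → ℝ) (v : Fin N → ℝ → Ket N) (G k : Fin N)
    (s : ℝ) : Ket N :=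
  (gap E G k s)⁻¹ • tunneling v G s

/-- An eigenframe with two energy levels that never cross: the level of `G`, and one shared by
all other labels. The label `k` is a representative of the latter. -/
structure IsTwoLevel (H : ℝ → Op N) (E : Fin N → ℝ → ℝ) (v : Fin N → ℝ → Ket N)
    (G k : Fin N) : Prop extends IsEigenframe H E v where
  degenerate : ∀ n, n ≠ G → EqOn (E n) (E k) (Icc 0 1)
  gap_ne_zero : ∀ s ∈ Icc (0 : ℝ) 1, gap E G k s ≠ 0

namespace IsTwoLevel

variable (h : IsTwoLevel H E v G k)
include h

theorem minGap_eq_sInf_image : minGap E = sInf ((fun s => |gap E G k s|) '' Icc 0 1) := by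
  rw [minGap]
  congr 1
  ext g
  constructor
  · rintro ⟨s, hs, n, m, hnm, rfl⟩
    refine ⟨s, hs, ?_⟩
    simp only [gap]
    rcases eq_or_ne n G with rfl | hn
    · rw [h.degenerate m (fun hm => hnm (by rw [hm])) hs, abs_sub_comm]
    · rcases eq_or_ne m G with rfl | hm
      · rw [h.degenerate n hn hs]
      · exact absurd ((h.degenerate n hn hs).trans (h.degenerate m hm hs).symm) hnm
  · rintro ⟨s, hs, rfl⟩
    exact ⟨s, hs, k, G, sub_ne_zero.1 (h.gap_ne_zero s hs), rfl⟩

theorem isCompact_image_abs_gap (hH : DifferentiableOn ℝ H (Icc 0 1)) :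
    IsCompact ((fun s => |gap E G k s|) '' Icc 0 1) :=
  isCompact_Icc.image_of_continuousOn
    ((h.continuousOn_energy hH k).sub (h.continuousOn_energy hH G)).abs

theorem minGap_pos (hH : DifferentiableOn ℝ H (Icc 0 1)) : 0 < minGap E := by
  obtain ⟨s, hs, hmin⟩ :=
    (h.isCompact_image_abs_gap hH).sInf_mem ((nonempty_Icc.2 zero_le_one).image _)
  rw [h.minGap_eq_sInf_image, ← hmin]
  exact abs_pos.2 (h.gap_ne_zero s hs)

variable (hs : s ∈ Icc (0 : ℝ) 1)
include hs

theorem minGap_le (hH : DifferentiableOn ℝ H (Icc 0 1)) : minGap E ≤ |gap E G k s| := by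
  rw [h.minGap_eq_sInf_image]
  exact csInf_le (h.isCompact_image_abs_gap hH).bddBelow ⟨s, hs, rfl⟩

theorem beta_eq_zero {n m : Fin N} (hn : n ≠ G) (hm : m ≠ G) : beta v n m s = 0 :=
  h.gauge n m ((h.degenerate n hn).trans (h.degenerate m hm).symm) s hs

theorem excitedCoords_hamiltonian (x : Ket N) :
    excitedCoords ℂ (v · s) G (H s x) = (E k s : ℂ) • excitedCoords ℂ (v · s) G x := by
  ext n
  by_cases hn : n = G
  · simp [hn]
  · rw [PiLp.smul_apply, smul_eq_mul, excitedCoords_apply_of_ne _ hn,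
      excitedCoords_apply_of_ne _ hn, h.inner_hamiltonian hs, h.degenerate n hn hs]

theorem excitedCoords_dot_hamiltonian (hH : DifferentiableOn ℝ H (Icc 0 1)) :
    excitedCoords ℂ (v · s) G (dot H s (v G s)) = gap E G k s • tunneling v G s := by
  ext n
  by_cases hn : n = G
  · simp [hn, h.beta_self hs]
  · rw [excitedCoords_apply_of_ne _ hn, h.inner_dot_hamiltonian hs hH hn,
      h.degenerate n hn hs, PiLp.smul_apply, tunneling_apply, Complex.real_smul, gap,
      Complex.ofReal_sub]

theorem norm_tunneling_le (hH : DifferentiableOn ℝ H (Icc 0 1)) {γ : ℝ} (hγ : 0 < γ)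
    (hgap : γ ≤ |gap E G k s|) : ‖tunneling v G s‖ ≤ ‖dot H s‖ / γ := by
  rw [le_div_iff₀ hγ]
  calc ‖tunneling v G s‖ * γ ≤ |gap E G k s| * ‖tunneling v G s‖ := by
        rw [mul_comm]
        gcongr
    _ = ‖excitedCoords ℂ (v · s) G (dot H s (v G s))‖ := by
        rw [h.excitedCoords_dot_hamiltonian hs hH, norm_smul, Real.norm_eq_abs]
    _ ≤ ‖dot H s (v G s)‖ := norm_excitedCoords_le (h.orthonormal s hs) G _
    _ ≤ ‖dot H s‖ := h.norm_apply_le hs _ G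

theorem inner_dot_eq_beta_mul {n : Fin N} (hn : n ≠ G) (x : Ket N) :
    inner ℂ (dot (v n) s) x = beta v n G s * inner ℂ (v G s) x := by
  rw [← (h.basis hs).sum_inner_mul_inner, Finset.sum_eq_single G]
  · simp only [h.coe_basis hs, beta]
  · intro m _ hm
    rw [h.coe_basis hs]
    exact mul_eq_zero_of_left (h.beta_eq_zero hs hn hm) _
  · exact fun hG => absurd (Finset.mem_univ G) hG

theorem hasDerivWithinAt_excitedCoords {x : ℝ → Ket N} {x' : Ket N}
    (hx : HasDerivWithinAt x x' (Icc 0 1) s) :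
    HasDerivWithinAt (fun t => excitedCoords ℂ (v · t) G (x t))
      ((inner ℂ (v G s) (x s) : ℂ) • tunneling v G s + excitedCoords ℂ (v · s) G x')
      (Icc 0 1) s := by
  suffices hcoord : ∀ n, HasDerivWithinAt (fun t => excitedCoords ℂ (v · t) G (x t) n)
      (((inner ℂ (v G s) (x s) : ℂ) • tunneling v G s + excitedCoords ℂ (v · s) G x') n)
      (Icc 0 1) s from
    (hasFDerivWithinAt_piLp 2).2 fun n =>
      (hcoord n).hasFDerivWithinAt.congr_fderiv (by ext; simp)
  intro n
  by_cases hn : n = G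
  · subst hn
    simpa [h.beta_self hs] using hasDerivWithinAt_const s (Icc 0 1) (0 : ℂ)
  · simp only [excitedCoords_apply_of_ne _ hn, PiLp.add_apply, PiLp.smul_apply, tunneling_apply,
      smul_eq_mul]
    refine ((h.hasDerivWithinAt hs n).inner ℂ hx).congr_deriv ?_
    rw [h.inner_dot_eq_beta_mul hs hn]
    ring

theorem hasDerivWithinAt_gap (hH : DifferentiableOn ℝ H (Icc 0 1)) :
    HasDerivWithinAt (gap E G k) (dot (E k) s - dot (E G) s) (Icc 0 1) s :=
  have hdiff n : DifferentiableOn ℝ (E n) (Icc 0 1) := fun _ ht =>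
    (h.hellmann_feynman ht hH n).differentiableWithinAt
  (hasDerivWithinAt_dot hs (hdiff k)).sub (hasDerivWithinAt_dot hs (hdiff G))

theorem tunnelingOverGap_eq (hH : DifferentiableOn ℝ H (Icc 0 1)) :
    tunnelingOverGap E v G k s
      = (gap E G k s ^ 2)⁻¹ • excitedCoords ℂ (v · s) G (dot H s (v G s)) := by
  rw [h.excitedCoords_dot_hamiltonian hs hH, smul_smul, tunnelingOverGap]
  congr 1
  field_simp [h.gap_ne_zero s hs]

theorem norm_tunnelingOverGap_le (hH : DifferentiableOn ℝ H (Icc 0 1)) {γ : ℝ} (hγ : 0 < γ)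
    (hgap : γ ≤ |gap E G k s|) : ‖tunnelingOverGap E v G k s‖ ≤ ‖dot H s‖ / γ ^ 2 := by
  calc ‖tunnelingOverGap E v G k s‖ = |gap E G k s|⁻¹ * ‖tunneling v G s‖ := by
        rw [tunnelingOverGap, norm_smul, norm_inv, Real.norm_eq_abs]
    _ ≤ γ⁻¹ * (‖dot H s‖ / γ) := by
        gcongr
        exact h.norm_tunneling_le hs hH hγ hgap
    _ = ‖dot H s‖ / γ ^ 2 := by
        field_simp

variable (hH : TwiceDifferentiable H)
include hH

theorem hasDerivWithinAt_dot_hamiltonian_ground :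
    HasDerivWithinAt (fun t => dot H t (v G t))
      (dot (dot H) s (v G s) + dot H s (dot (v G) s)) (Icc 0 1) s :=
  hasDerivWithinAt_clm_apply (hasDerivWithinAt_dot hs hH.2) (h.hasDerivWithinAt hs G)

theorem hasDerivWithinAt_tunnelingOverGap :
    HasDerivWithinAt (tunnelingOverGap E v G k)
      ((gap E G k s ^ 2)⁻¹ • ((inner ℂ (v G s) (dot H s (v G s)) : ℂ) • tunneling v G s
          + excitedCoords ℂ (v · s) G (dot (dot H) s (v G s) + dot H s (dot (v G) s)))
        + (2 * (dot (E G) s - dot (E k) s) / gap E G k s ^ 2) • tunneling v G s)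
      (Icc 0 1) s := by
  have hne := h.gap_ne_zero s hs
  have hd := (((h.hasDerivWithinAt_gap hs hH.1).fun_pow 2).fun_inv (pow_ne_zero 2 hne)).fun_smul
    (h.hasDerivWithinAt_excitedCoords hs (h.hasDerivWithinAt_dot_hamiltonian_ground hs hH))
  refine (hd.congr_of_mem (fun t ht => h.tunnelingOverGap_eq ht hH.1) hs).congr_deriv ?_
  rw [h.excitedCoords_dot_hamiltonian hs hH.1, smul_smul]
  congr 2
  field_simp
  ring

theorem norm_dot_tunnelingOverGap_le {h₁ h₂ γ : ℝ} (hγ : 0 < γ) (hgap : γ ≤ |gap E G k s|)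
    (hh₁ : ‖dot H s‖ ≤ h₁) (hh₂ : ‖dot (dot H) s‖ ≤ h₂) :
    ‖dot (tunnelingOverGap E v G k) s‖ ≤ 6 * h₁ ^ 2 / γ ^ 3 + h₂ / γ ^ 2 := by
  have hh₁' : 0 ≤ h₁ := (norm_nonneg _).trans hh₁
  have htunneling : ‖tunneling v G s‖ ≤ h₁ / γ :=
    (h.norm_tunneling_le hs hH.1 hγ hgap).trans (by gcongr)
  have hground : ‖dot H s (v G s)‖ ≤ h₁ := (h.norm_apply_le hs _ G).trans hh₁
  have hsq : γ ^ 2 ≤ |gap E G k s ^ 2| := by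
    rw [abs_pow]
    gcongr
  have hinner : ‖(inner ℂ (v G s) (dot H s (v G s)) : ℂ) • tunneling v G s‖ ≤ h₁ * (h₁ / γ) := by
    rw [norm_smul]
    refine mul_le_mul ((norm_inner_le_norm _ _).trans ?_) htunneling (norm_nonneg _) hh₁'
    rwa [h.norm_eq_one hs, one_mul]
  have hexcited :
      ‖excitedCoords ℂ (v · s) G (dot (dot H) s (v G s) + dot H s (dot (v G) s))‖
        ≤ h₂ + h₁ * (h₁ / γ) := by
    refine (norm_excitedCoords_le (h.orthonormal s hs) G _).trans (norm_add_le_of_le ?_ ?_)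
    · exact (h.norm_apply_le hs _ G).trans hh₂
    · refine ((dot H s).le_opNorm _).trans ?_
      rw [h.norm_dot hs]
      gcongr
  have henergy : |2 * (dot (E G) s - dot (E k) s)| ≤ 4 * h₁ := by
    rw [abs_mul, abs_two]
    linarith [abs_sub (dot (E G) s) (dot (E k) s), h.abs_dot_energy_le hs hH.1 k,
      h.abs_dot_energy_le hs hH.1 G]
  rw [dot_eq hs (h.hasDerivWithinAt_tunnelingOverGap hs hH)]
  calc _ ≤ (γ ^ 2)⁻¹ * (h₁ * (h₁ / γ) + (h₂ + h₁ * (h₁ / γ))) + 4 * h₁ / γ ^ 2 * (h₁ / γ) := by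
        refine norm_add_le_of_le ?_ ?_ <;>
          rw [norm_smul, Real.norm_eq_abs]
        · rw [abs_inv]
          gcongr
          exact norm_add_le_of_le hinner hexcited
        · rw [abs_div]
          gcongr
    _ = 6 * h₁ ^ 2 / γ ^ 3 + h₂ / γ ^ 2 := by
        field_simp
        ring

end IsTwoLevel

/-- The relative dynamical phase `exp (i T ∫₀ˢ (E_1 - E_G))` of the interaction picture. -/
noncomputable def relativePhase (E : Fin N → ℝ → ℝ) (T : ℝ) (G k : Fin N) (s : ℝ) : ℂ :=
  (phase E T k 0 s)⁻¹ * phase E T G 0 s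

/-- The vector of tunneling amplitudes out of `G` in the interaction picture. -/
noncomputable def oscillatingTunneling (E : Fin N → ℝ → ℝ) (v : Fin N → ℝ → Ket N) (T : ℝ)
    (G k : Fin N) (s : ℝ) : Ket N :=
  relativePhase E T G k s • tunneling v G s

/-- The boundary term `(i T (E_1 - E_G))⁻¹ exp (i T ∫₀ˢ (E_1 - E_G)) β` of the integration by parts
of the oscillating tunneling amplitudes: a primitive of them up to terms of order `1 / T`. -/
noncomputable def approxPrimitive (E : Fin N → ℝ → ℝ) (v : Fin N → ℝ → Ket N) (T : ℝ)
    (G k : Fin N) (s : ℝ) : Ket N :=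
  (relativePhase E T G k s / (Complex.I * T)) • tunnelingOverGap E v G k s

theorem norm_relativePhase : ‖relativePhase E T G k s‖ = 1 := by
  rw [relativePhase, norm_mul, norm_inv, norm_phase, norm_phase, inv_one, one_mul]

theorem norm_relativePhase_div_smul (hT : 0 < T) (x : Ket N) :
    ‖(relativePhase E T G k s / (Complex.I * T)) • x‖ = ‖x‖ / T := by
  rw [norm_smul, norm_div, norm_relativePhase, norm_mul, Complex.norm_I, one_mul,
    Complex.norm_of_nonneg hT.le, div_mul_eq_mul_div, one_mul]

/-- The coefficient of `v G` in the interaction picture. -/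
noncomputable def groundAmplitude (E : Fin N → ℝ → ℝ) (v : Fin N → ℝ → Ket N) (T : ℝ) (G : Fin N)
    (ψ : ℝ → Ket N) (s : ℝ) : ℂ :=
  (phase E T G 0 s)⁻¹ * inner ℂ (v G s) (ψ s)

/-- The coefficients of the labels other than `G` in the interaction picture. -/
noncomputable def excitedAmplitude (E : Fin N → ℝ → ℝ) (v : Fin N → ℝ → Ket N) (T : ℝ)
    (G k : Fin N) (ψ : ℝ → Ket N) (s : ℝ) : Ket N :=
  (phase E T k 0 s)⁻¹ • excitedCoords ℂ (v · s) G (ψ s)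

theorem norm_excitedAmplitude (ψ : ℝ → Ket N) :
    ‖excitedAmplitude E v T G k ψ s‖ = ‖excitedCoords ℂ (v · s) G (ψ s)‖ := by
  rw [excitedAmplitude, norm_smul, norm_inv, norm_phase, inv_one, one_mul]

theorem IsEigenframe.norm_groundAmplitude_le (h : IsEigenframe H E v) (hs : s ∈ Icc (0 : ℝ) 1)
    (ψ : ℝ → Ket N) : ‖groundAmplitude E v T G ψ s‖ ≤ ‖ψ s‖ := by
  rw [groundAmplitude, norm_mul, norm_inv, norm_phase, inv_one, one_mul]
  simpa only [h.norm_eq_one hs, one_mul] using norm_inner_le_norm (𝕜 := ℂ) (v G s) (ψ s)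

theorem IsEigenframe.hasDerivWithinAt_groundAmplitude (h : IsEigenframe H E v)
    (hs : s ∈ Icc (0 : ℝ) 1) (hH : DifferentiableOn ℝ H (Icc 0 1)) {ψ : ℝ → Ket N}
    (hψ : HasDerivWithinAt ψ (-(Complex.I * (T : ℂ)) • H s (ψ s)) (Icc 0 1) s) :
    HasDerivWithinAt (groundAmplitude E v T G ψ)
      (-((phase E T G 0 s)⁻¹
        * inner ℂ (tunneling v G s) (excitedCoords ℂ (v · s) G (ψ s)))) (Icc 0 1) s := by
  refine ((hasDerivWithinAt_phase_inv (h.continuousOn_energy hH G) hs).mul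
    ((h.hasDerivWithinAt hs G).inner ℂ hψ)).congr_deriv ?_
  rw [inner_smul_right, h.inner_hamiltonian hs, h.inner_dot_left hs]
  ring

namespace IsTwoLevel

variable (h : IsTwoLevel H E v G k)
include h

section Oscillation

variable (hs : s ∈ Icc (0 : ℝ) 1)
include hs

theorem hasDerivWithinAt_relativePhase (hH : DifferentiableOn ℝ H (Icc 0 1)) :
    HasDerivWithinAt (relativePhase E T G k)
      (Complex.I * T * gap E G k s * relativePhase E T G k s) (Icc 0 1) s := by
  refine ((hasDerivWithinAt_phase_inv (h.continuousOn_energy hH k) hs).mul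
    (hasDerivWithinAt_phase (h.continuousOn_energy hH G) hs)).congr_deriv ?_
  rw [relativePhase, gap, Complex.ofReal_sub]
  ring

theorem hasDerivWithinAt_approxPrimitive (hH : TwiceDifferentiable H) (hT : T ≠ 0) :
    HasDerivWithinAt (approxPrimitive E v T G k)
      (oscillatingTunneling E v T G k s
        + (relativePhase E T G k s / (Complex.I * T)) • dot (tunnelingOverGap E v G k) s)
      (Icc 0 1) s := by
  have htunneling : HasDerivWithinAt (tunnelingOverGap E v G k)
      (dot (tunnelingOverGap E v G k) s) (Icc 0 1) s :=
    (h.hasDerivWithinAt_tunnelingOverGap hs hH).differentiableWithinAt.hasDerivWithinAt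
  refine (((h.hasDerivWithinAt_relativePhase hs hH.1).div_const _).smul
    htunneling).congr_deriv ?_
  rw [add_comm, oscillatingTunneling, tunnelingOverGap, ← Complex.coe_smul, smul_smul]
  congr 2
  have hT' : (T : ℂ) ≠ 0 := Complex.ofReal_ne_zero.2 hT
  have hgap : (gap E G k s : ℂ) ≠ 0 := Complex.ofReal_ne_zero.2 (h.gap_ne_zero s hs)
  push_cast
  field_simp

omit hs in
theorem continuousOn_oscillatingTunneling (hH : TwiceDifferentiable H) :
    ContinuousOn (oscillatingTunneling E v T G k) (Icc 0 1) := by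
  have htunneling : ContinuousOn (fun t => gap E G k t • tunnelingOverGap E v G k t) (Icc 0 1) :=
    fun t ht => ((h.hasDerivWithinAt_gap ht hH.1).smul
      (h.hasDerivWithinAt_tunnelingOverGap ht hH)).continuousWithinAt
  exact ContinuousOn.smul (fun t ht =>
    (h.hasDerivWithinAt_relativePhase ht hH.1).continuousWithinAt) (htunneling.congr fun t ht =>
    (smul_inv_smul₀ (h.gap_ne_zero t ht) _).symm)

end Oscillation

theorem hasDerivWithinAt_excitedAmplitude (hs : s ∈ Icc (0 : ℝ) 1)
    (hH : DifferentiableOn ℝ H (Icc 0 1)) {ψ : ℝ → Ket N}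
    (hψ : HasDerivWithinAt ψ (-(Complex.I * (T : ℂ)) • H s (ψ s)) (Icc 0 1) s) :
    HasDerivWithinAt (excitedAmplitude E v T G k ψ)
      (groundAmplitude E v T G ψ s • oscillatingTunneling E v T G k s) (Icc 0 1) s := by
  refine ((hasDerivWithinAt_phase_inv (h.continuousOn_energy hH k) hs).smul
    (h.hasDerivWithinAt_excitedCoords hs hψ)).congr_deriv ?_
  have hne : phase E T G 0 s ≠ 0 := phase_ne_zero
  rw [excitedCoords_smul, h.excitedCoords_hamiltonian hs, groundAmplitude, oscillatingTunneling,
    relativePhase]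
  match_scalars <;> field_simp
  ring

theorem norm_excitedAmplitude_sub_integral_le (hsa : ∀ s ∈ Icc (0 : ℝ) 1, IsSelfAdjoint (H s))
    (hH : TwiceDifferentiable H) (hT : 0 < T) {h₁ h₂ γ : ℝ} (hγ : 0 < γ)
    (hgap : ∀ s ∈ Icc (0 : ℝ) 1, γ ≤ |gap E G k s|)
    (hh₁ : ∀ s ∈ Icc (0 : ℝ) 1, ‖dot H s‖ ≤ h₁)
    (hh₂ : ∀ s ∈ Icc (0 : ℝ) 1, ‖dot (dot H) s‖ ≤ h₂) {ψ : ℝ → Ket N}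
    (hψ : ∀ s ∈ Icc (0 : ℝ) 1,
      HasDerivWithinAt ψ (-(Complex.I * (T : ℂ)) • H s (ψ s)) (Icc 0 1) s)
    (hψ₀ : ψ 0 = v G 0) :
    ‖excitedAmplitude E v T G k ψ 1 - ∫ s in (0 : ℝ)..1, oscillatingTunneling E v T G k s‖
      ≤ Gam h₁ h₂ γ / (h₁ * T) * (Real.exp (Gam h₁ h₂ γ / (γ * T)) - 1) := by
  have h0 : (0 : ℝ) ∈ Icc (0 : ℝ) 1 := left_mem_Icc.2 zero_le_one
  have hh₁_nonneg : 0 ≤ h₁ := (norm_nonneg _).trans (hh₁ 0 h0)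
  have hground_le : ∀ s ∈ Icc (0 : ℝ) 1, ‖groundAmplitude E v T G ψ s‖ ≤ 1 := fun s hs =>
    (h.norm_groundAmplitude_le hs ψ).trans_eq
      (by rw [norm_eq_of_schrodinger hsa hψ hs, hψ₀, h.norm_eq_one h0])
  have hground'_le : ∀ s ∈ Icc (0 : ℝ) 1, ‖-((phase E T G 0 s)⁻¹
      * inner ℂ (tunneling v G s) (excitedCoords ℂ (v · s) G (ψ s)))‖
        ≤ h₁ / γ * ‖excitedAmplitude E v T G k ψ s‖ := fun s hs => by
    rw [norm_neg, norm_mul, norm_inv, norm_phase, inv_one, one_mul, norm_excitedAmplitude]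
    refine (norm_inner_le_norm _ _).trans ?_
    gcongr
    exact (h.norm_tunneling_le hs hH.1 hγ (hgap s hs)).trans (by gcongr; exact hh₁ s hs)
  have hprimitive_le : ∀ s ∈ Icc (0 : ℝ) 1, ‖approxPrimitive E v T G k s‖ ≤ h₁ / γ ^ 2 / T :=
    fun s hs => by
      rw [approxPrimitive, norm_relativePhase_div_smul hT]
      gcongr
      exact (h.norm_tunnelingOverGap_le hs hH.1 hγ (hgap s hs)).trans (by gcongr; exact hh₁ s hs)
  have hremainder_le : ∀ s ∈ Icc (0 : ℝ) 1,
      ‖(relativePhase E T G k s / (Complex.I * T)) • dot (tunnelingOverGap E v G k) s‖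
        ≤ (6 * h₁ ^ 2 / γ ^ 3 + h₂ / γ ^ 2) / T := fun s hs => by
    rw [norm_relativePhase_div_smul hT]
    gcongr
    exact h.norm_dot_tunnelingOverGap_le hs hH hγ (hgap s hs) (hh₁ s hs) (hh₂ s hs)
  have hbound := norm_sub_le_of_approxPrimitive (by positivity)
    (fun s hs => h.hasDerivWithinAt_groundAmplitude hs hH.1 (hψ s hs))
    (fun s hs => h.hasDerivWithinAt_excitedAmplitude hs hH.1 (hψ s hs))
    (fun s hs => h.hasDerivWithinAt_approxPrimitive hs hH hT.ne')
    hground_le hground'_le hprimitive_le hremainder_le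
    (by rw [excitedAmplitude, hψ₀, excitedCoords_self (h.orthonormal 0 h0), smul_zero])
    (by simp [groundAmplitude, hψ₀, phase_self, h.norm_eq_one h0])
    (fun s hs => hasDerivWithinAt_integral_Icc (h.continuousOn_oscillatingTunneling hH) hs)
    intervalIntegral.integral_same (right_mem_Icc.2 zero_le_one)
  simp only [sub_zero, mul_one] at hbound
  exact hbound.trans (mul_sq_mul_exp_le_gam hh₁_nonneg hγ hT rfl rfl
    ((norm_nonneg _).trans (hremainder_le 0 h0)))

end IsTwoLevel

section Paths

variable {q : ℕ} {ν : Fin (q + 1) → Fin N}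

theorem pathAmplitude_eq_zero_of_beta_eq_zero (i : Fin q)
    (hβ : ∀ s ∈ Icc (0 : ℝ) 1, beta v (ν i.succ) (ν i.castSucc) s = 0) :
    ∀ x ∈ Icc (0 : ℝ) 1, pathAmplitude E v T q ν x = 0 := by
  induction q with
  | zero => exact i.elim0
  | succ q ih =>
    intro x hx
    refine intervalIntegral.integral_zero_ae (Filter.Eventually.of_forall fun s hs => ?_)
    rw [uIoc_of_le hx.1] at hs
    have hs : s ∈ Icc (0 : ℝ) 1 := ⟨hs.1.le, hs.2.trans hx.2⟩
    induction i using Fin.lastCases with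
    | last => exact mul_eq_zero_of_left (mul_eq_zero_of_right _ (hβ s hs)) _
    | cast i => exact mul_eq_zero_of_right _ (ih i hβ s hs)

theorem eq_iff_even_of_alternating (h₀ : ν 0 = G) (hne : ∀ i : Fin q, ν i.succ ≠ ν i.castSucc)
    (hG : ∀ i : Fin q, ν i.succ = G ∨ ν i.castSucc = G) (i : Fin (q + 1)) :
    ν i = G ↔ Even (i : ℕ) := by
  induction i using Fin.induction with
  | zero => simp [h₀]
  | succ i ih =>
    rw [Fin.val_succ, Nat.even_add_one, ← Fin.val_castSucc, ← ih]
    exact ⟨fun hs hc => hne i (hs.trans hc.symm), (hG i).resolve_right⟩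

theorem jumpContribution_eq_zero_of_even
    (hβ : ∀ s ∈ Icc (0 : ℝ) 1, ∀ n m, n ≠ G → m ≠ G → beta v n m s = 0) (hq : Even q) :
    jumpContribution E v T G q = 0 := by
  refine Finset.sum_eq_zero fun ν hν => ?_
  obtain ⟨h₀, hne, hlast⟩ := (Finset.mem_filter.1 hν).2
  obtain ⟨i, hi⟩ : ∃ i : Fin q, ¬(ν i.succ = G ∨ ν i.castSucc = G) := by
    by_contra! hG
    exact hlast ((eq_iff_even_of_alternating h₀ hne hG (Fin.last q)).2 hq)
  rw [not_or] at hi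
  rw [pathAmplitude_eq_zero_of_beta_eq_zero i (fun s hs => hβ s hs _ _ hi.1 hi.2) 1
    (right_mem_Icc.2 zero_le_one), zero_smul]

theorem jumpContribution_one_eq_sum :
    jumpContribution E v T G 1
      = ∑ n with n ≠ G, (∫ s in (0 : ℝ)..1, phase E T n s 1 * beta v n G s * phase E T G 0 s)
          • v n 1 := by
  refine Finset.sum_bij' (fun ν _ => ν 1) (fun n _ => ![G, n]) ?_ ?_ ?_ ?_ ?_
  · intro ν hν
    exact Finset.mem_filter.2 ⟨Finset.mem_univ _, (Finset.mem_filter.1 hν).2.2.2⟩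
  · intro n hn
    have hnG := (Finset.mem_filter.1 hn).2
    exact Finset.mem_filter.2 ⟨Finset.mem_univ _, rfl, Fin.forall_fin_one.2 hnG, hnG⟩
  · intro ν hν
    have hν₀ := (Finset.mem_filter.1 hν).2.1
    exact funext (Fin.forall_fin_two.2 ⟨hν₀.symm, rfl⟩)
  · exact fun _ _ => rfl
  · intro ν hν
    have hν₀ := (Finset.mem_filter.1 hν).2.1
    rw [← hν₀]
    rfl

end Paths

theorem IsEigenframe.adiabaticError_eq (h : IsEigenframe H E v) (U : ℝ → Op N) :
    adiabaticError U v G = (h.basis (right_mem_Icc.2 zero_le_one)).repr.symm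
      (excitedCoords ℂ (v · 1) G (U 1 (v G 0))) := by
  have hrepr := repr_symm_excitedCoords (h.basis (right_mem_Icc.2 zero_le_one)) G (U 1 (v G 0))
  rw [h.coe_basis] at hrepr
  exact hrepr.symm

namespace IsTwoLevel

variable (h : IsTwoLevel H E v G k)
include h

theorem phase_eq_mul_phase_inv (hH : DifferentiableOn ℝ H (Icc 0 1)) {n : Fin N} (hn : n ≠ G)
    (hs : s ∈ Icc (0 : ℝ) 1) :
    phase E T n s 1 = phase E T k 0 1 * (phase E T k 0 s)⁻¹ := by
  have h1 : (1 : ℝ) ∈ Icc (0 : ℝ) 1 := right_mem_Icc.2 zero_le_one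
  rw [phase_congr hs h1 (h.degenerate n hn), ← phase_mul_phase (h.continuousOn_energy hH k)
    (left_mem_Icc.2 zero_le_one) hs h1, mul_comm, inv_mul_cancel_left₀ phase_ne_zero]

theorem integral_oscillatingTunneling_apply (hH : TwiceDifferentiable H) (n : Fin N) :
    (∫ s in (0 : ℝ)..1, oscillatingTunneling E v T G k s) n
      = ∫ s in (0 : ℝ)..1, relativePhase E T G k s * beta v n G s :=
  ((EuclideanSpace.proj (𝕜 := ℂ) n).intervalIntegral_comp_comm
    ((h.continuousOn_oscillatingTunneling hH).intervalIntegrable_of_Icc zero_le_one)).symm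

theorem integral_one_jump (hH : TwiceDifferentiable H) {n : Fin N} (hn : n ≠ G) :
    ∫ s in (0 : ℝ)..1, phase E T n s 1 * beta v n G s * phase E T G 0 s
      = phase E T k 0 1 * (∫ s in (0 : ℝ)..1, oscillatingTunneling E v T G k s) n := by
  rw [h.integral_oscillatingTunneling_apply hH, ← intervalIntegral.integral_const_mul]
  refine intervalIntegral.integral_congr fun s hs => ?_
  rw [uIcc_of_le zero_le_one] at hs
  simp only [h.phase_eq_mul_phase_inv hH.1 hn hs, relativePhase]
  ring

theorem jumpContribution_one_eq (hH : TwiceDifferentiable H) :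
    jumpContribution E v T G 1 = (h.basis (right_mem_Icc.2 zero_le_one)).repr.symm
      (phase E T k 0 1 • ∫ s in (0 : ℝ)..1, oscillatingTunneling E v T G k s) := by
  have hG : (∫ s in (0 : ℝ)..1, oscillatingTunneling E v T G k s) G = 0 := by
    rw [h.integral_oscillatingTunneling_apply hH]
    refine intervalIntegral.integral_zero_ae (Filter.Eventually.of_forall fun s hs => ?_)
    rw [uIoc_of_le zero_le_one] at hs
    rw [h.beta_self (Ioc_subset_Icc_self hs), mul_zero]
  rw [jumpContribution_one_eq_sum, ← OrthonormalBasis.sum_repr_symm, Finset.sum_filter]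
  refine Finset.sum_congr rfl fun n _ => ?_
  split_ifs with hn
  · rw [h.integral_one_jump hH hn, h.coe_basis]
    rfl
  · rw [not_not.1 hn, PiLp.smul_apply, hG, smul_zero, zero_smul]

theorem norm_adiabaticError_sub (hH : TwiceDifferentiable H) (U : ℝ → Op N) :
    ‖adiabaticError U v G - jumpContribution E v T G 1‖
      = ‖excitedAmplitude E v T G k (fun s => U s (v G 0)) 1
        - ∫ s in (0 : ℝ)..1, oscillatingTunneling E v T G k s‖ := by
  have hphase : excitedCoords ℂ (v · 1) G (U 1 (v G 0))
      = phase E T k 0 1 • excitedAmplitude E v T G k (fun s => U s (v G 0)) 1 :=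
    (smul_inv_smul₀ phase_ne_zero _).symm
  rw [h.adiabaticError_eq, h.jumpContribution_one_eq hH, ← map_sub, LinearIsometryEquiv.norm_map,
    hphase, ← smul_sub, norm_smul, norm_phase, one_mul]

end IsTwoLevel

end Adiabatic

theorem corollary3 {N : ℕ} (hN : 2 ≤ N)
    (H : ℝ → Adiabatic.Op N)
    (hsa : ∀ s ∈ Set.Icc (0 : ℝ) 1, IsSelfAdjoint (H s))
    (hdiff : Adiabatic.TwiceDifferentiable H)
    (hbdd : BddAbove ((fun s => ‖Adiabatic.dot (Adiabatic.dot H) s‖) '' Set.Icc 0 1))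
    (E : Fin N → ℝ → ℝ) (v : Fin N → ℝ → Adiabatic.Ket N)
    (hframe : Adiabatic.IsEigenframe H E v)
    (G : Fin N) (E₁ : ℝ → ℝ)
    (hexc : ∀ s ∈ Set.Icc (0 : ℝ) 1, ∀ n, n ≠ G → E n s = E₁ s)
    (hgap : ∀ s ∈ Set.Icc (0 : ℝ) 1, E G s ≠ E₁ s)
    (T : ℝ) (hT : 0 < T)
    (U : ℝ → Adiabatic.Op N) (hU : Adiabatic.IsTimeEvolution H T U)
    (h₁ h₂ γ Γ : ℝ)
    (hh₁ : h₁ = Adiabatic.maxNorm (Adiabatic.dot H))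
    (hh₂ : h₂ = Adiabatic.maxNorm (Adiabatic.dot (Adiabatic.dot H)))
    (hγ : γ = Adiabatic.minGap E)
    (hΓ : Γ = Adiabatic.Gam h₁ h₂ γ) :
    (∀ m : ℕ, Adiabatic.jumpContribution E v T G (2 * m) = 0) ∧
    ‖Adiabatic.adiabaticError U v G - Adiabatic.jumpContribution E v T G 1‖ ≤
      Γ / (h₁ * T) * (Real.exp (Γ / (γ * T)) - 1) := by
  have : Nontrivial (Fin N) := Fin.nontrivial_iff_two_le.2 hN
  obtain ⟨k, hk⟩ := exists_ne G
  have h : Adiabatic.IsTwoLevel H E v G k :=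
    { hframe with
      degenerate := fun n hn s hs => (hexc s hs n hn).trans (hexc s hs k hk).symm
      gap_ne_zero := fun s hs =>
        sub_ne_zero.2 fun he => hgap s hs (he.symm.trans (hexc s hs k hk)) }
  have hbdd₁ : BddAbove ((fun s => ‖Adiabatic.dot H s‖) '' Icc 0 1) :=
    (isCompact_Icc.image_of_continuousOn hdiff.2.continuousOn.norm).bddAbove
  subst hΓ hh₁ hh₂ hγ
  refine ⟨fun m => Adiabatic.jumpContribution_eq_zero_of_even
    (fun s hs n m hn hm => h.beta_eq_zero hs hn hm) (even_two_mul m), ?_⟩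
  rw [h.norm_adiabaticError_sub hdiff U]
  exact h.norm_excitedAmplitude_sub_integral_le hsa hdiff hT (h.minGap_pos hdiff.1)
    (fun s hs => h.minGap_le hs hdiff.1) (fun s hs => Adiabatic.norm_le_maxNorm hs hbdd₁)
    (fun s hs => Adiabatic.norm_le_maxNorm hs hbdd)
    (fun s hs => hU.hasDerivWithinAt_apply (v G 0) hs) (by simp [hU.initial])
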